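/- **Conventions.** For a group $G$ put $\mathrm{tor}_0(G)=\{e\}$, let $\mathrm{tor}_{i+1}(G)$ be the normal closure in $G$ of the set of all $g\in G$ such that $g\,\mathrm{tor}_i(G)$ has finite order in $G/\mathrm{tor}_i(G)$, and put $\mathrm{tor}_\infty(G)=\bigcup_{i\in\mathbb N}\mathrm{tor}_i(G)$. The torsion length $\mathrm{torlen}(G)\in\mathbb N\cup\{\infty\}$ is the least $n$ with $\mathrm{tor}_n(G)=\mathrm{tor}_\infty(G)$, and $\infty$ if there is no such $n$. For a presentation $P=\langle X\mid R\rangle$ let $\overline P$ be the group it presents. A countably generated recursive presentation is given by two programs, one enumerating a set of generators $X\subseteq\{x_1,x_2,\dots\}$ and one enumerating a set $R$ of words in $X^{\pm1}$; a $2$-generator recursive presentation is given by a program enumerating a set of words in two fixed generators and their inverses. A finite presentation has generators $x_1,\dots,x_n$ ($n\ge 0$) and a finite list of relators. For a presentation $P=\langle X\mid R\rangle$ of one of these kinds, let $\mathrm{tgen}(P)$ be the presentation with two generators $a,t$ whose relators are obtained from those in $R$ by substituting, for each $x_i$, the word $$t\,a^{-i}b\,a^{i}\,t^{-1}\,b^{-i}a^{-1}b^{i},\qquad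 b:=t^{-1}at .$$ (This is what remains of the presentation $\langle X,a,b,t\mid R,\ t^{-1}at=b,\ t^{-1}x_ib^{-i}ab^{i}t=a^{-i}ba^{i}\ (x_i\in X)\rangle$ after eliminating $X$ and $b$.) **Theorem.** 1. There is an algorithm that, from the two programs giving a countably generated recursive presentation $P$, computes a program giving the $2$-generator recursive presentation $\mathrm{tgen}(P)$. For every such $P$, sending each $x_i\in X$ to the element of $\overline{\mathrm{tgen}(P)}$ represented by the above word defines an injective homomorphism $\overline P\to\overline{\mathrm{tgen}(P)}$, and $\mathrm{torlen}(\overline{\mathrm{tgen}(P)})=\mathrm{torlen}(\overline P)$. 2. There is an algorithm that, from a finite presentation $P$, computes the $2$-generator finite presentation $\mathrm{tgen}(P)$. For every such $P$, the same assignment defines an injective homomorphism $\overline P\to\overline{\mathrm{tgen}(P)}$, and $\mathrm{torlen}(\overline{\mathrm{tgen}(P)})=\mathrm{torlen}(\overline P)$. -/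

import Mathlib

namespace TorsionLength

/-! ### The torsion series and the torsion length of a group -/

/-- The subgroups `tor_i(G)`, together with their normality: `tor_0(G)` is trivial, and
`tor_{i+1}(G)` is the normal closure in `G` of all `g` whose image in `G / tor_i(G)` is torsion. -/
def torsionSeriesAux (G : Type*) [Group G] : ℕ → {N : Subgroup G // N.Normal}
  | 0 => ⟨⊥, inferInstance⟩
  | i + 1 =>
    let N := torsionSeriesAux G i
    haveI := N.2
    ⟨Subgroup.normalClosure {g : G | IsOfFinOrder (QuotientGroup.mk g : G ⧸ N.1)}, inferInstance⟩

/-- The subgroup `tor_i(G)`. -/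
def torsionSeries (G : Type*) [Group G] (i : ℕ) : Subgroup G :=
  (torsionSeriesAux G i).1

/-- The set `tor_∞(G)`, the union of all `tor_i(G)`. -/
def torsionInfty (G : Type*) [Group G] : Set G :=
  ⋃ i : ℕ, (torsionSeries G i : Set G)

/-- The torsion length: the least `n` with `tor_n(G) = tor_∞(G)`, and `⊤` if there is none
(the infimum of the empty set in `ℕ∞` is `⊤`). -/
noncomputable def torlen (G : Type*) [Group G] : ℕ∞ :=
  sInf ((fun n : ℕ => (n : ℕ∞)) '' {n : ℕ | (torsionSeries G n : Set G) = torsionInfty G})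

/-! ### Words, recursive enumerations and presentations -/

/-- Words in the letters `α` and their formal inverses: `(x, true)` stands for `x`
and `(x, false)` for `x⁻¹`, as in Mathlib's `FreeGroup.mk`. -/
abbrev Word (α : Type) : Type := List (α × Bool)

/-- The set of objects of type `α` enumerated by a program `c`, that is, the range of the partial
recursive function computed by `c`. (Programs need not be total, so the empty set and the finite
sets are included, and these are exactly the recursively enumerable sets.) -/
def enumerated (α : Type) [Primcodable α] (c : Nat.Partrec.Code) : Set α :=
  {x | ∃ n : ℕ, Encodable.encode x ∈ c.eval n}

/-- A countably generated recursive presentation. It consists of a program enumerating the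
generators, and a program enumerating the relators, which are words in these generators. The
generators are letters named by natural numbers; the letter `k` is the generator `x_{k+1}`.
Every (finite or infinite) recursively enumerable set of letters is allowed. -/
structure CountablyGenRecPresentation where
  genCode : Nat.Partrec.Code
  relCode : Nat.Partrec.Code
  letters_mem : ∀ w ∈ enumerated (Word ℕ) relCode, ∀ l ∈ w, l.1 ∈ enumerated ℕ genCode

namespace CountablyGenRecPresentation

/-- The set of generators. -/
def gens (P : CountablyGenRecPresentation) : Set ℕ := enumerated ℕ P.genCode

/-- The set of relators. -/
def relators (P : CountablyGenRecPresentation) : Set (Word ℕ) := enumerated (Word ℕ) P.relCode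

/-- The relators as elements of the free group on the generators. -/
def relatorElements (P : CountablyGenRecPresentation) : Set (FreeGroup P.gens) :=
  {r | ∃ w : Word P.gens,
    w.map (fun l => ((l.1 : ℕ), l.2)) ∈ P.relators ∧ FreeGroup.mk w = r}

/-- The group given by the presentation. -/
abbrev presentedGroup (P : CountablyGenRecPresentation) : Type :=
  PresentedGroup P.relatorElements

end CountablyGenRecPresentation

/-- An `n`-generator recursive presentation: a program enumerating a set of relators,
which are words in `n` generators. -/
structure RecPresentation (n : ℕ) where
  relCode : Nat.Partrec.Code

namespace RecPresentation

/-- The set of relators. -/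
def relators {n : ℕ} (P : RecPresentation n) : Set (Word (Fin n)) :=
  enumerated (Word (Fin n)) P.relCode

/-- The group given by the presentation. -/
abbrev presentedGroup {n : ℕ} (P : RecPresentation n) : Type :=
  PresentedGroup (FreeGroup.mk '' P.relators)

end RecPresentation

/-- An `n`-generator finite presentation: a finite list of relators,
which are words in `n` generators. -/
structure FinPresentation (n : ℕ) where
  relators : List (Word (Fin n))

namespace FinPresentation

/-- The group given by the presentation. -/
abbrev presentedGroup {n : ℕ} (P : FinPresentation n) : Type :=
  PresentedGroup (FreeGroup.mk '' {w : Word (Fin n) | w ∈ P.relators})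

/-- A word in the letters `Fin n`, read as a word in the letters `ℕ`. -/
def natWord {n : ℕ} (w : Word (Fin n)) : Word ℕ := w.map (fun l => ((l.1 : ℕ), l.2))

/-- A finite presentation written out as a finite string of data, to be the input of an
algorithm: the number of generators and the list of relators. -/
def data {n : ℕ} (P : FinPresentation n) : ℕ × List (Word ℕ) :=
  (n, P.relators.map natWord)

end FinPresentation

/-! ### The 2-generator presentation

For a presentation `P = ⟨X | R⟩` one forms the HNN extension of the free product of the group of
`P` with the free group on `a, b`, with stable letter `t`,
`⟨X, a, b, t | R, t⁻¹ x_i b⁻ⁱ a bⁱ t = a⁻ⁱ b aⁱ⟩`, where `i = 0` (with `x_0` empty) and all `i`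
with `x_i ∈ X` are used. The relations say `b = t⁻¹ a t` and
`x_i = t a⁻ⁱ b aⁱ t⁻¹ b⁻ⁱ a⁻¹ bⁱ`. Eliminating `b` and `X` by means of them leaves the generators
`a, t`, and the relators `R` with these words substituted. -/

/-- The letter `a`. -/
def wordA : Word (Fin 2) := [(0, true)]

/-- The letter `t`. -/
def wordT : Word (Fin 2) := [(1, true)]

/-- The word `t⁻¹ a t`, which replaces `b`. -/
def wordB : Word (Fin 2) := FreeGroup.invRev wordT ++ wordA ++ wordT

/-- The `i`-th power of a word. -/
def wordPow {α : Type} (w : Word α) (i : ℕ) : Word α := (List.replicate i w).flatten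

/-- The word `t a⁻ⁱ b aⁱ t⁻¹ b⁻ⁱ a⁻¹ bⁱ`, with `b = t⁻¹ a t`. -/
def wordX (i : ℕ) : Word (Fin 2) :=
  wordT ++ wordPow (FreeGroup.invRev wordA) i ++ wordB ++ wordPow wordA i ++
    FreeGroup.invRev wordT ++ wordPow (FreeGroup.invRev wordB) i ++
    FreeGroup.invRev wordA ++ wordPow wordB i

/-- Substitution of the words `wordX (k + 1)` for the letters `k` (that is, for `x_{k+1}`). -/
def substWord (w : Word ℕ) : Word (Fin 2) :=
  w.flatMap (fun l => bif l.2 then wordX (l.1 + 1) else FreeGroup.invRev (wordX (l.1 + 1)))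

/-- The 2-generator finite presentation obtained from a finite presentation. -/
def FinPresentation.tgen {n : ℕ} (P : FinPresentation n) : FinPresentation 2 :=
  ⟨P.relators.map (fun w => substWord (FinPresentation.natWord w))⟩

/-- `Q` is the 2-generator recursive presentation obtained from `P`: its relators are the
relators of `P` after substitution. -/
def IsTgen (P : CountablyGenRecPresentation) (Q : RecPresentation 2) : Prop :=
  Q.relators = substWord '' P.relators

end TorsionLength

/-! Let G be the given group, H the 2-generator group, φ : G → H the substitution. The HNN
construction works over every quotient of G. For N normal in G, adjoin free letters a, b to G/N. The
elements a⁻ᵏ b aᵏ freely generate a subgroup, as do the x_k b⁻ᵏ a bᵏ (kill G/N to see this), where k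
runs over 0 (with x_0 = 1) and the indices of the generators. So a stable letter t can conjugate the
first family to the second. The resulting group L is H modulo the normal closure M of φ(N), since b
and the x_k can be eliminated (`exists_hnn_coding`, `exists_recognition`).

Hence G/N embeds in H/M. Torsion in an HNN extension is conjugate into the base
(`exists_isConj_of_of_isOfFinOrder`); applied to t and to the two free letters, this makes all
torsion of H/M conjugate into the image of G/N. By induction tor_i(H) is the normal closure of
φ(tor_i(G)), and it meets φ(G) exactly in φ(tor_i(G)). The two torsion series therefore have the
same inclusions, so the torsion lengths agree. Injectivity of φ is the case N = 1. -/

namespace TorsionLength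

/-! ### Torsion in HNN extensions -/

section HNN

open HNNExtension

variable {G : Type*} [Group G] {A B : Subgroup G} {φ : A ≃* B}

/-- The product of the syllables `t ^ u * g` of a list of pairs `(u, g)`. -/
def syllableProd (φ : A ≃* B) (l : List (ℤˣ × G)) : HNNExtension G A B φ :=
  (l.map fun p => t ^ (p.1 : ℤ) * of p.2).prod

@[simp] theorem syllableProd_nil : syllableProd φ [] = 1 := rfl

@[simp] theorem syllableProd_cons (p : ℤˣ × G) (l : List (ℤˣ × G)) :
    syllableProd φ (p :: l) = t ^ (p.1 : ℤ) * of p.2 * syllableProd φ l := by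
  simp [syllableProd]

@[simp] theorem syllableProd_append (l l' : List (ℤˣ × G)) :
    syllableProd φ (l ++ l') = syllableProd φ l * syllableProd φ l' := by
  simp [syllableProd]

theorem syllableProd_flatten_replicate (l : List (ℤˣ × G)) (n : ℕ) :
    syllableProd φ (List.replicate n l).flatten = syllableProd φ l ^ n := by
  induction n with
  | zero => simp
  | succ n ih => simp [List.replicate_succ, ih, pow_succ']

theorem exists_eq_of_mul_syllableProd (x : HNNExtension G A B φ) :
    ∃ (g : G) (l : List (ℤˣ × G)), x = of g * syllableProd φ l := by
  obtain ⟨d⟩ := NormalWord.TransversalPair.nonempty G A B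
  exact ⟨_, _, ((NormalWord.equiv φ d).symm_apply_apply x).symm⟩

/-- An inner cancellation `t ^ u * g * t ^ (-u)` with `g` in the associated subgroup. -/
theorem exists_conj_of_mem_toSubgroup {u : ℤˣ} {g : G} (hg : g ∈ toSubgroup A B u) :
    ∃ g' : G, (t ^ (u : ℤ) * of g * t ^ ((-u : ℤˣ) : ℤ) : HNNExtension G A B φ) = of g' := by
  rcases Int.units_eq_one_or u with rfl | rfl
  · exact ⟨φ ⟨g, hg⟩, by simpa using (equiv_eq_conj (φ := φ) ⟨g, hg⟩).symm⟩
  · exact ⟨φ.symm ⟨g, hg⟩, by simpa using (equiv_symm_eq_conj (φ := φ) ⟨g, hg⟩).symm⟩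

/-- A word that is not cyclically reduced, written so that the failure is at its start, is
conjugate to a shorter one or to an element of the base group. -/
theorem exists_shorter_conj {u : ℤˣ} {g g₂ : G} (hg : g ∈ toSubgroup A B u)
    (l : List (ℤˣ × G)) :
    ∃ (g' : G) (l' : List (ℤˣ × G)), l'.length < l.length + 2 ∧
      IsConj (syllableProd φ ((u, g) :: (-u, g₂) :: l)) (of g' * syllableProd φ l') := by
  obtain ⟨g', hg'⟩ := exists_conj_of_mem_toSubgroup (φ := φ) hg
  refine ⟨g' * g₂, l, by lia, ?_⟩
  rw [show syllableProd φ ((u, g) :: (-u, g₂) :: l) = of (g' * g₂) * syllableProd φ l by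
    rw [map_mul, ← hg']; simp [mul_assoc]]

theorem isConj_syllableProd_append (l l' : List (ℤˣ × G)) :
    IsConj (syllableProd φ (l ++ l')) (syllableProd φ (l' ++ l)) :=
  isConj_iff.2 ⟨(syllableProd φ l)⁻¹, by simp⟩

theorem exists_syllableProd_append (g : G) (l : List (ℤˣ × G)) (hl : l ≠ []) :
    ∃ l' : List (ℤˣ × G), l'.length = l.length ∧
      syllableProd φ l' = syllableProd φ l * of g := by
  obtain ⟨m, p, rfl⟩ := List.eq_nil_or_concat l |>.resolve_left hl
  exact ⟨m ++ [(p.1, p.2 * g)], by simp, by simp [mul_assoc]⟩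

/-- Every element is conjugate to an element of the base group or to a nonempty word all of
whose powers are reduced. -/
theorem exists_conj_cyclically_reduced (x : HNNExtension G A B φ) :
    (∃ g : G, IsConj x (of g)) ∨ ∃ l : List (ℤˣ × G), l ≠ [] ∧ IsConj x (syllableProd φ l) ∧
      ∀ n : ℕ, (List.replicate n l).flatten.IsChain
        (fun a b => a.2 ∈ toSubgroup A B a.1 → a.1 = b.1) := by
  classical
  by_cases hbase : ∃ g : G, IsConj x (of g)
  · exact .inl hbase
  right
  -- A representative with fewest stable letters in the whole conjugacy class is cyclically reduced:
  -- any pinch, even across the ends, would shorten it.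
  have hex : ∃ n, ∃ (g : G) (l : List (ℤˣ × G)), l.length = n ∧
      IsConj x (of g * syllableProd φ l) := by
    obtain ⟨g, l, h⟩ := exists_eq_of_mul_syllableProd x
    exact ⟨_, g, l, rfl, h ▸ IsConj.refl x⟩
  obtain ⟨g, l, hlen, hconj⟩ := Nat.find_spec hex
  have hmin : ∀ (g' : G) (l' : List (ℤˣ × G)), IsConj x (of g' * syllableProd φ l') →
      l.length ≤ l'.length := fun g' l' h => hlen ▸ Nat.find_min' hex ⟨g', l', rfl, h⟩
  have hl : l ≠ [] := by
    rintro rfl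
    exact hbase ⟨g, by simpa using hconj⟩
  obtain ⟨m, hm, hmprod⟩ := exists_syllableProd_append (φ := φ) g l hl
  have hmconj : IsConj x (syllableProd φ m) :=
    hconj.trans (isConj_iff.2 ⟨(of g)⁻¹, by rw [hmprod]; group⟩)
  have hm0 : m ≠ [] := by
    rintro rfl
    exact hl (List.length_eq_zero_iff.1 hm.symm)
  have hpair : ∀ (p q : ℤˣ × G) (k : List (ℤˣ × G)), IsConj x (syllableProd φ (p :: q :: k)) →
      k.length + 2 = l.length → p.2 ∈ toSubgroup A B p.1 → p.1 = q.1 := by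
    intro p q k hk hklen hp
    by_contra hne
    obtain ⟨u, g₁⟩ := p
    obtain ⟨v, g₂⟩ := q
    obtain rfl : v = -u := by
      rcases Int.units_eq_one_or u with rfl | rfl <;>
        rcases Int.units_eq_one_or v with rfl | rfl <;> simp_all
    obtain ⟨g', l', hlt, hc⟩ := exists_shorter_conj (φ := φ) (g₂ := g₂) hp k
    have := hmin _ _ (hk.trans hc)
    lia
  have hchain : m.IsChain (fun a b => a.2 ∈ toSubgroup A B a.1 → a.1 = b.1) := by
    rw [List.isChain_iff_forall_rel_of_append_cons_cons]
    rintro p q k₁ k₂ rfl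
    refine hpair p q (k₂ ++ k₁) (hmconj.trans ?_) (by simp at hm ⊢; lia)
    simpa using isConj_syllableProd_append (φ := φ) k₁ (p :: q :: k₂)
  -- The junction between consecutive copies of `m` in a power; a rotation brings it to the front.
  have hends : ∀ p ∈ m.getLast?, ∀ q ∈ m.head?, p.2 ∈ toSubgroup A B p.1 → p.1 = q.1 := by
    intro p hp q hq
    rcases m with _ | ⟨q', k⟩
    · simp at hq
    obtain rfl : q' = q := by simpa using hq
    rcases List.eq_nil_or_concat k with rfl | ⟨k', p', rfl⟩
    · obtain rfl : q' = p := by simpa using hp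
      exact fun _ => rfl
    obtain rfl : p' = p := by simpa [List.getLast?_cons] using hp
    refine hpair p' q' k' (hmconj.trans ?_) (by simp at hm ⊢; lia)
    simpa using isConj_syllableProd_append (φ := φ) (q' :: k') [p']
  refine ⟨m, hm0, hmconj, fun n => ?_⟩
  induction n with
  | zero => simp
  | succ n ih =>
    rw [List.replicate_succ, List.flatten_cons]
    refine hchain.append ih fun p hp q hq => ?_
    refine hends p hp q ?_
    rcases n with _ | n
    · simp at hq
    · simpa [List.replicate_succ, List.head?_append_of_ne_nil _ hm0] using hq

/-- Elements of finite order of an HNN extension are conjugate into the base group. -/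
theorem exists_isConj_of_of_isOfFinOrder {x : HNNExtension G A B φ} (hx : IsOfFinOrder x) :
    ∃ g : G, IsOfFinOrder g ∧ IsConj x (of g) := by
  rcases exists_conj_cyclically_reduced x with ⟨g, hg⟩ | ⟨l, hl, hconj, hred⟩
  · refine ⟨g, ?_, hg⟩
    obtain ⟨n, hn, hxn⟩ := isOfFinOrder_iff_pow_eq_one.1 hx
    refine isOfFinOrder_iff_pow_eq_one.2 ⟨n, hn, of_injective (φ := φ) ?_⟩
    obtain ⟨c, hc⟩ := isConj_iff.1 hg
    rw [map_pow, ← hc, conj_pow, hxn]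
    simp
  · exfalso
    obtain ⟨n, hn, hxn⟩ := isOfFinOrder_iff_pow_eq_one.1 hx
    let w : NormalWord.ReducedWord G A B := ⟨1, (List.replicate n l).flatten, hred n⟩
    have hw : w.prod φ = 1 := by
      have hw' : w.prod φ = of 1 * syllableProd φ (List.replicate n l).flatten := rfl
      obtain ⟨c, hc⟩ := isConj_iff.1 hconj
      rw [hw', syllableProd_flatten_replicate, ← hc, conj_pow, hxn]
      simp
    -- Britton's lemma: a reduced word lying in the base has no stable letters, but this power has
    -- some.
    have := ReducedWord.toList_eq_nil_of_mem_of_range φ w (hw ▸ one_mem _)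
    simp only [w, List.flatten_eq_nil_iff, List.mem_replicate] at this
    exact hl (this l ⟨hn.ne', rfl⟩)

end HNN

/-! ### The torsion length of an overgroup -/

section Torlen

variable {G H : Type*} [Group G] [Group H]

instance torsionSeries_normal (i : ℕ) : (torsionSeries G i).Normal :=
  (torsionSeriesAux G i).2

@[simp] theorem torsionSeries_zero : torsionSeries G 0 = ⊥ := rfl

theorem isOfFinOrder_quotientMk_iff {N : Subgroup G} [N.Normal] {g : G} :
    IsOfFinOrder (QuotientGroup.mk g : G ⧸ N) ↔ ∃ n : ℕ, 0 < n ∧ g ^ n ∈ N := by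
  simp only [isOfFinOrder_iff_pow_eq_one, ← QuotientGroup.mk_pow, QuotientGroup.eq_one_iff]

theorem torsionSeries_succ (i : ℕ) :
    torsionSeries G (i + 1) =
      Subgroup.normalClosure {g : G | ∃ n : ℕ, 0 < n ∧ g ^ n ∈ torsionSeries G i} := by
  simp_rw [← isOfFinOrder_quotientMk_iff]
  rfl

theorem torsionSeries_monotone : Monotone (torsionSeries G) :=
  monotone_nat_of_le_succ fun i g hg => by
    rw [torsionSeries_succ]
    exact Subgroup.subset_normalClosure ⟨1, one_pos, by simpa using hg⟩

/-- Makes the torsion length depend only on the inclusions between terms of the series. -/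
theorem torsionSeries_eq_torsionInfty_iff (n : ℕ) :
    (torsionSeries G n : Set G) = torsionInfty G ↔
      ∀ m, torsionSeries G m ≤ torsionSeries G n := by
  rw [torsionInfty]
  constructor
  · intro h m
    rw [← SetLike.coe_subset_coe, h]
    exact Set.subset_iUnion (fun i => (torsionSeries G i : Set G)) m
  · intro h
    exact (Set.subset_iUnion (fun i => (torsionSeries G i : Set G)) n).antisymm
      (Set.iUnion_subset h)

variable {φ : G →* H}

/-- If `φ` induces embeddings of all quotients of `G`, in such a way that the elements of finite
order are conjugate into the image, then it maps the torsion series to the torsion series. -/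
theorem torsionSeries_eq_normalClosure_image
    (hinter : ∀ N : Subgroup G, N.Normal → ∀ g, φ g ∈ Subgroup.normalClosure (φ '' N) → g ∈ N)
    (htors : ∀ N : Subgroup G, N.Normal → ∀ (h : H) (n : ℕ), 0 < n →
      h ^ n ∈ Subgroup.normalClosure (φ '' N) →
      ∃ (c : H) (g : G), (c * φ g * c⁻¹)⁻¹ * h ∈ Subgroup.normalClosure (φ '' N)) (i : ℕ) :
    torsionSeries H i = Subgroup.normalClosure (φ '' (torsionSeries G i)) := by
  induction i with
  | zero =>
    refine bot_le.antisymm (Subgroup.normalClosure_le_normal ?_)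
    simp
  | succ i ih =>
    apply le_antisymm
    · rw [torsionSeries_succ]
      refine Subgroup.normalClosure_le_normal ?_
      rintro h ⟨n, hn, hh⟩
      rw [ih] at hh
      obtain ⟨c, g, hcg⟩ := htors _ inferInstance h n hn hh
      have hle : Subgroup.normalClosure (φ '' (torsionSeries G i)) ≤
          Subgroup.normalClosure (φ '' (torsionSeries G (i + 1))) :=
        Subgroup.normalClosure_mono (Set.image_mono (torsionSeries_monotone i.le_succ))
      -- Modulo `M`, `φ g` is conjugate to `h`, so its `n`-th power dies; `hinter` pulls this back
      -- to `G`.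
      have hgn : g ^ n ∈ torsionSeries G i := by
        refine hinter _ inferInstance _ ?_
        set M := Subgroup.normalClosure (φ '' (torsionSeries G i : Set G))
        have h1 : (QuotientGroup.mk (c * φ g * c⁻¹) : H ⧸ M) = QuotientGroup.mk h :=
          QuotientGroup.eq.2 hcg
        have h2 : (QuotientGroup.mk (c * φ g ^ n * c⁻¹) : H ⧸ M) = 1 := by
          rw [← conj_pow, QuotientGroup.mk_pow, h1, ← QuotientGroup.mk_pow]
          exact (QuotientGroup.eq_one_iff _).2 hh
        have h3 := (QuotientGroup.eq_one_iff _).1 h2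
        simpa [mul_assoc] using Subgroup.normalClosure_normal.conj_mem _ h3 c⁻¹
      have hg : g ∈ torsionSeries G (i + 1) := by
        rw [torsionSeries_succ]
        exact Subgroup.subset_normalClosure ⟨n, hn, hgn⟩
      have := mul_mem (Subgroup.normalClosure_normal.conj_mem _
        (Subgroup.subset_normalClosure (Set.mem_image_of_mem φ hg)) c) (hle hcg)
      rwa [mul_inv_cancel_left] at this
    · refine Subgroup.normalClosure_le_normal ?_
      rw [Set.image_subset_iff, torsionSeries_succ]
      refine Subgroup.normalClosure_le_normal (N := (torsionSeries H (i + 1)).comap φ) ?_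
      rintro g ⟨n, hn, hg⟩
      rw [SetLike.mem_coe, Subgroup.mem_comap, torsionSeries_succ]
      refine Subgroup.subset_normalClosure ⟨n, hn, ?_⟩
      rw [ih, ← map_pow]
      exact Subgroup.subset_normalClosure (Set.mem_image_of_mem φ hg)

theorem torlen_eq_of_torsion_conj
    (hinter : ∀ N : Subgroup G, N.Normal → ∀ g, φ g ∈ Subgroup.normalClosure (φ '' N) → g ∈ N)
    (htors : ∀ N : Subgroup G, N.Normal → ∀ (h : H) (n : ℕ), 0 < n →
      h ^ n ∈ Subgroup.normalClosure (φ '' N) →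
      ∃ (c : H) (g : G), (c * φ g * c⁻¹)⁻¹ * h ∈ Subgroup.normalClosure (φ '' N)) :
    torlen H = torlen G := by
  have hle : ∀ m n, Subgroup.normalClosure (φ '' (torsionSeries G m : Set G)) ≤
      Subgroup.normalClosure (φ '' (torsionSeries G n : Set G)) ↔
      torsionSeries G m ≤ torsionSeries G n := by
    intro m n
    refine ⟨fun h g hg => ?_, fun h => Subgroup.normalClosure_mono (Set.image_mono h)⟩
    exact hinter _ inferInstance g (h (Subgroup.subset_normalClosure (Set.mem_image_of_mem φ hg)))
  simp only [torlen, torsionSeries_eq_torsionInfty_iff]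
  simp only [torsionSeries_eq_normalClosure_image hinter htors, hle]

end Torlen

/-! ### The HNN extension in which the generators become words in `a` and `t` -/

/-- The element `t a⁻ⁱ b aⁱ t⁻¹ b⁻ⁱ a⁻¹ bⁱ` with `b = t⁻¹ a t`. -/
def codedElement {M : Type*} [Group M] (a t : M) (i : ℕ) : M :=
  t * (a⁻¹ ^ i * (t⁻¹ * a * t) * a ^ i) * t⁻¹ *
    ((t⁻¹ * a * t)⁻¹ ^ i * a⁻¹ * (t⁻¹ * a * t) ^ i)

theorem map_codedElement {M M' : Type*} [Group M] [Group M'] (f : M →* M') (a t : M) (i : ℕ) :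
    f (codedElement a t i) = codedElement (f a) (f t) i := by
  simp [codedElement]

/-! ### Free subgroups generated by conjugates -/

section Freeness

/-- The shift automorphism of the free group on `ℤ`, as an action of `ℤ`. -/
def shiftAction : Multiplicative ℤ →* MulAut (FreeGroup ℤ) :=
  zpowersHom _ (FreeGroup.freeGroupCongr (Equiv.addRight (1 : ℤ)))

theorem shiftAction_ofAdd_of (n : ℕ) (k : ℤ) :
    shiftAction (Multiplicative.ofAdd (n : ℤ)) (FreeGroup.of k) = FreeGroup.of (k + n) := by
  induction n with
  | zero => simp
  | succ n ih =>
    rw [Nat.cast_succ, add_comm, ofAdd_add, map_mul, MulAut.mul_apply, ih]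
    simp [shiftAction, add_assoc, add_comm]

/-- If a group maps to the semidirect product of the free group on `ℤ` with `ℤ`, so that `s` and
`y i` map to the generators, up to a factor which dies, then the conjugates are free. -/
theorem injective_lift_of_conj {K J : Type*} [Group K] {ι : J → ℕ} (hι : Function.Injective ι)
    (y : J → K) (r : K →* FreeGroup ℤ ⋊[shiftAction] Multiplicative ℤ)
    (hy : ∀ j, r (y j) = (SemidirectProduct.inr (Multiplicative.ofAdd (1 : ℤ)))⁻¹ ^ (ι j) *
      SemidirectProduct.inl (FreeGroup.of 0) *
      SemidirectProduct.inr (Multiplicative.ofAdd (1 : ℤ)) ^ (ι j)) :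
    Function.Injective (FreeGroup.lift y) := by
  -- Conjugating by a power of the shift moves the generator 0 to `-ι j`, so distinct `j` give
  -- distinct free generators.
  have hcomp : r.comp (FreeGroup.lift y) =
      SemidirectProduct.inl.comp (FreeGroup.map fun j => -(ι j : ℤ)) := by
    refine FreeGroup.ext_hom _ _ fun j => ?_
    have h := shiftAction_ofAdd_of (ι j) (-(ι j : ℤ))
    rw [neg_add_cancel] at h
    simp only [MonoidHom.comp_apply, FreeGroup.lift_apply_of, FreeGroup.map.of, hy, ← h,
      SemidirectProduct.inl_aut]
    have : Multiplicative.ofAdd (ι j : ℤ) = Multiplicative.ofAdd (1 : ℤ) ^ (ι j) := by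
      rw [← ofAdd_nsmul]; simp
    rw [this]
    simp only [map_pow, map_inv, inv_pow]
    group
  have hinj : Function.Injective (r.comp (FreeGroup.lift y)) := by
    rw [hcomp]
    refine SemidirectProduct.inl_injective.comp (FreeGroup.map_injective fun i j h => hι ?_)
    simpa using h
  exact Function.Injective.of_comp hinj

end Freeness

open HNNExtension in
/-- The free product of `Q` with an infinite cyclic group: an HNN extension with trivial
associated subgroups. -/
abbrev FreeStableLetter (Q : Type*) [Group Q] : Type _ :=
  HNNExtension Q ⊥ ⊥ (MulEquiv.refl (⊥ : Subgroup Q))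

open HNNExtension in
-- Building the free product with a free group as two HNN extensions lets the same torsion theorem
-- handle it.
theorem exists_adjoin_two_free_letters (Q : Type) [Group Q] :
    ∃ (K : Type) (_ : Group K) (j : Q →* K) (a b : K), Function.Injective j ∧
      (∀ h : K, IsOfFinOrder h → ∃ g, IsConj h (j g)) ∧
      ∀ (M : Type) [Group M] (f : Q →* M) (a' b' : M),
        ∃ F : K →* M, (∀ g, F (j g) = f g) ∧ F a = a' ∧ F b = b' := by
  refine ⟨FreeStableLetter (FreeStableLetter Q), inferInstance, of.comp of, of t, t,
    (of_injective _).comp (of_injective _), fun h hh => ?_, fun M _ f a' b' => ?_⟩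
  · obtain ⟨g, hg', hg⟩ := exists_isConj_of_of_isOfFinOrder hh
    obtain ⟨g', -, hg'⟩ := exists_isConj_of_of_isOfFinOrder hg'
    exact ⟨g', hg.trans (of.map_isConj hg')⟩
  · refine ⟨lift (lift f a' fun x => ?_) b' fun x => ?_, fun g => ?_, ?_, ?_⟩
    · obtain ⟨x, hx⟩ := x
      obtain rfl := Subgroup.mem_bot.1 hx
      simp
    · obtain ⟨x, hx⟩ := x
      obtain rfl := Subgroup.mem_bot.1 hx
      simp
    all_goals simp

open HNNExtension in
theorem exists_hnn_coding (Q : Type) [Group Q] {I : Type} {ι : I → ℕ}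
    (hι : Function.Injective ι) (x : I → Q) :
    ∃ (L : Type) (_ : Group L) (j : Q →* L) (a t : L), Function.Injective j ∧
      (∀ i, j (x i) = codedElement a t (ι i + 1)) ∧
      (∀ h : L, IsOfFinOrder h → ∃ g, IsConj h (j g)) ∧
      ∀ (M : Type) [Group M] (f : Q →* M) (a' t' : M),
        (∀ i, f (x i) = codedElement a' t' (ι i + 1)) →
        ∃ F : L →* M, (∀ g, F (j g) = f g) ∧ F a = a' ∧ F t = t' := by
  obtain ⟨K, _, k, a, b, hk, htors, hlift⟩ := exists_adjoin_two_free_letters Q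
  -- The extra index `none`, with exponent 0 and trivial `x'`, yields `t b t⁻¹ = a`, which makes `b`
  -- redundant; the shift by 1 keeps the other exponents away from 0.
  let κ : Option I → ℕ := fun o => o.elim 0 fun i => ι i + 1
  have hκ : Function.Injective κ := by
    rintro (_ | i) (_ | i') h
    · rfl
    · simp [κ] at h
    · simp [κ] at h
    · simpa [κ, hι.eq_iff] using h
  let x' : Option I → Q := fun o => o.elim 1 x
  obtain ⟨y, hy⟩ : ∃ y : Option I → K, ∀ o, y o = a⁻¹ ^ κ o * b * a ^ κ o :=
    ⟨_, fun _ => rfl⟩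
  obtain ⟨z, hz⟩ : ∃ z : Option I → K, ∀ o, z o = k (x' o) * (b⁻¹ ^ κ o * a * b ^ κ o) :=
    ⟨_, fun _ => rfl⟩
  have hyinj : Function.Injective (FreeGroup.lift y) := by
    obtain ⟨r, hr, hra, hrb⟩ := hlift _ (1 : Q →* FreeGroup ℤ ⋊[shiftAction] Multiplicative ℤ)
      (SemidirectProduct.inr (Multiplicative.ofAdd (1 : ℤ)))
      (SemidirectProduct.inl (FreeGroup.of 0))
    exact injective_lift_of_conj hκ y r fun o => by simp [hy, hra, hrb]
  -- The roles of `a` and `b` are swapped; killing `Q` removes the factors `x' o`.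
  have hzinj : Function.Injective (FreeGroup.lift z) := by
    obtain ⟨r, hr, hra, hrb⟩ := hlift _ (1 : Q →* FreeGroup ℤ ⋊[shiftAction] Multiplicative ℤ)
      (SemidirectProduct.inl (FreeGroup.of 0))
      (SemidirectProduct.inr (Multiplicative.ofAdd (1 : ℤ)))
    exact injective_lift_of_conj hκ z r fun o => by simp [hz, hr, hra, hrb]
  obtain ⟨φ, hφ⟩ : ∃ φ : (FreeGroup.lift y).range ≃* (FreeGroup.lift z).range,
      ∀ w, φ ⟨FreeGroup.lift y w, w, rfl⟩ = ⟨FreeGroup.lift z w, w, rfl⟩ := by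
    refine ⟨(MonoidHom.ofInjective hyinj).symm.trans (MonoidHom.ofInjective hzinj), fun w => ?_⟩
    have : (⟨FreeGroup.lift y w, w, rfl⟩ : (FreeGroup.lift y).range) =
      MonoidHom.ofInjective hyinj w := rfl
    rw [this, MulEquiv.trans_apply, MulEquiv.symm_apply_apply]
    rfl
  have hrel : ∀ o, (t * of (y o) : HNNExtension K _ _ φ) = of (z o) * t := fun o => by
    have := t_mul_of (φ := φ) ⟨FreeGroup.lift y (FreeGroup.of o), _, rfl⟩
    rw [hφ] at this
    simpa using this
  have hb : (of b : HNNExtension K _ _ φ) = t⁻¹ * of a * t := by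
    have := hrel none
    simp only [hy, hz, κ, x', Option.elim_none, pow_zero, one_mul, mul_one, map_one] at this
    rw [mul_assoc, ← this, inv_mul_cancel_left]
  refine ⟨HNNExtension K _ _ φ, inferInstance, of.comp k, of a, t, (of_injective _).comp hk,
    fun i => ?_, fun h hh => ?_, fun M _ f a' t' hf => ?_⟩
  · have := hrel (some i)
    simp only [hy, hz, κ, x', Option.elim_some, map_mul, map_pow, map_inv] at this
    rw [codedElement, ← hb, this]
    simp [mul_assoc]
  · obtain ⟨g, hg', hg⟩ := exists_isConj_of_of_isOfFinOrder hh
    obtain ⟨g', hg'⟩ := htors g hg'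
    exact ⟨g', hg.trans (of.map_isConj hg')⟩
  · obtain ⟨F, hF, hFa, hFb⟩ := hlift M f a' (t'⁻¹ * a' * t')
    have hyz : ∀ o, t' * F (y o) = F (z o) * t' := by
      rintro (_ | i)
      · simp [hy, hz, κ, x', hFa, hFb, mul_assoc]
      · simp only [hy, hz, κ, x', Option.elim_some, map_mul, map_pow, map_inv, hF, hf, hFa, hFb,
          codedElement]
        generalize t'⁻¹ * a' * t' = b'
        group
    have hyz' : (((MulAut.conj t').toMonoidHom.comp F).comp (FreeGroup.lift y)) =
        F.comp (FreeGroup.lift z) :=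
      FreeGroup.ext_hom _ _ fun o => by simp [hyz]
    have hlift' : ∀ w : (FreeGroup.lift y).range, t' * F w = F (φ w) * t' := by
      rintro ⟨_, w, rfl⟩
      have := DFunLike.congr_fun hyz' w
      simp only [MonoidHom.comp_apply, MulEquiv.coe_toMonoidHom, MulAut.conj_apply] at this
      rw [hφ, ← this, inv_mul_cancel_right]
    exact ⟨lift F t' hlift', fun g => by simp [hF], by simp [hFa], by simp⟩

/-! ### The 2-generator presentation -/

theorem mk_wordPow {α : Type} (w : Word α) (i : ℕ) :
    FreeGroup.mk (wordPow w i) = FreeGroup.mk w ^ i := by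
  induction i with
  | zero => rfl
  | succ i ih =>
    rw [pow_succ', ← ih, FreeGroup.mul_mk]
    simp [wordPow, List.replicate_succ]

theorem mk_wordX (i : ℕ) :
    FreeGroup.mk (wordX i) = codedElement (FreeGroup.of 0) (FreeGroup.of 1) i := by
  have hA : FreeGroup.mk wordA = FreeGroup.of 0 := rfl
  have hT : FreeGroup.mk wordT = FreeGroup.of 1 := rfl
  have hB : FreeGroup.mk wordB =
      (FreeGroup.of 1)⁻¹ * FreeGroup.of 0 * FreeGroup.of 1 := by
    rw [wordB, ← FreeGroup.mul_mk, ← FreeGroup.mul_mk, ← FreeGroup.inv_mk, hA, hT]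
  simp only [wordX, ← FreeGroup.mul_mk, mk_wordPow, ← FreeGroup.inv_mk, hA, hT, hB, codedElement,
    mul_assoc]

section Presented

variable {I : Type} {ι : I → ℕ} {rels : Set (FreeGroup I)}

/-- The substitution of `wordX (ι k + 1)` for the generator `k`. -/
def substHom (ι : I → ℕ) : FreeGroup I →* FreeGroup (Fin 2) :=
  FreeGroup.lift fun k => FreeGroup.mk (wordX (ι k + 1))

/-- The homomorphism of presented groups induced by the substitution. -/
def tgenHom (ι : I → ℕ) (rels : Set (FreeGroup I)) :
    PresentedGroup rels →* PresentedGroup (substHom ι '' rels) :=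
  PresentedGroup.map (substHom ι) fun _ hr => Set.mem_image_of_mem _ hr

/-- For every normal subgroup `N`, the group with two generators, modulo the normal closure of
the image of `N`, is recognized in an HNN extension of a group containing the quotient by `N`. -/
theorem exists_recognition (hι : Function.Injective ι) (N : Subgroup (PresentedGroup rels))
    [N.Normal] :
    ∃ (L : Type) (_ : Group L) (j : PresentedGroup rels ⧸ N →* L)
      (q : PresentedGroup (substHom ι '' rels) →* L)
      (F : L →* PresentedGroup (substHom ι '' rels) ⧸
        Subgroup.normalClosure (tgenHom ι rels '' N)),
      Function.Injective j ∧
      (∀ g, q (tgenHom ι rels g) = j (QuotientGroup.mk g)) ∧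
      (∀ h : L, IsOfFinOrder h → ∃ g, IsConj h (j g)) ∧
      ∀ h, F (q h) = QuotientGroup.mk h := by
  obtain ⟨L, _, j, a, t, hj, hx, htors, hlift⟩ := exists_hnn_coding (PresentedGroup rels ⧸ N) hι
    fun k => QuotientGroup.mk (PresentedGroup.of k)
  have hsubst : (FreeGroup.lift ![a, t]).comp (substHom ι) =
      (j.comp (QuotientGroup.mk' N)).comp (PresentedGroup.mk rels) := by
    refine FreeGroup.ext_hom _ _ fun k => ?_
    simp only [MonoidHom.comp_apply, substHom, FreeGroup.lift_apply_of, mk_wordX,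
      map_codedElement]
    exact (hx k).symm
  have hrels : ∀ r ∈ substHom ι '' rels, FreeGroup.lift ![a, t] r = 1 := by
    rintro _ ⟨r, hr, rfl⟩
    have h1 : PresentedGroup.mk rels r = 1 := PresentedGroup.one_of_mem hr
    simpa [h1] using DFunLike.congr_fun hsubst r
  set M := Subgroup.normalClosure (tgenHom ι rels '' N)
  have hle : N ≤ M.comap (tgenHom ι rels) := fun g hg =>
    Subgroup.subset_normalClosure (Set.mem_image_of_mem _ hg)
  obtain ⟨F, hF, hFa, hFt⟩ := hlift _ (QuotientGroup.map N M (tgenHom ι rels) hle)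
    (QuotientGroup.mk (PresentedGroup.of 0)) (QuotientGroup.mk (PresentedGroup.of 1)) fun k => by
      have : tgenHom ι rels (PresentedGroup.of k) =
          codedElement (PresentedGroup.of 0) (PresentedGroup.of 1) (ι k + 1) := by
        have : tgenHom ι rels (PresentedGroup.of k) =
          PresentedGroup.mk _ (substHom ι (FreeGroup.of k)) := rfl
        rw [this, substHom, FreeGroup.lift_apply_of, mk_wordX, map_codedElement]
        rfl
      rw [QuotientGroup.map_mk, this]
      exact map_codedElement (QuotientGroup.mk' M) _ _ _
  refine ⟨L, inferInstance, j, PresentedGroup.toGroup hrels, F, hj, fun g => ?_, htors,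
    fun h => ?_⟩
  · obtain ⟨w, rfl⟩ := PresentedGroup.mk_surjective _ g
    exact DFunLike.congr_fun hsubst w
  -- Both maps agree on the generators `a` and `t`.
  · have : F.comp (PresentedGroup.toGroup hrels) = QuotientGroup.mk' M := by
      refine PresentedGroup.ext fun i => ?_
      fin_cases i
      · simpa using hFa
      · simpa using hFt
    exact DFunLike.congr_fun this h

theorem normalClosure_le_ker_of_eq_comp_mk {G H L : Type*} [Group G] [Group H] [Group L]
    {N : Subgroup G} [N.Normal] {φ : G →* H} {q : H →* L} {j : G ⧸ N →* L}
    (hq : ∀ g, q (φ g) = j (QuotientGroup.mk g)) :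
    Subgroup.normalClosure (φ '' N) ≤ q.ker := by
  refine Subgroup.normalClosure_le_normal ?_
  rintro _ ⟨x, hx, rfl⟩
  rw [SetLike.mem_coe, MonoidHom.mem_ker, hq, (QuotientGroup.eq_one_iff x).2 hx, map_one]

theorem mem_of_tgenHom_mem (hι : Function.Injective ι) (N : Subgroup (PresentedGroup rels))
    (hN : N.Normal) (g : PresentedGroup rels)
    (hg : tgenHom ι rels g ∈ Subgroup.normalClosure (tgenHom ι rels '' N)) : g ∈ N := by
  obtain ⟨L, _, j, q, F, hj, hq, -, -⟩ := exists_recognition hι N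
  have hle := normalClosure_le_ker_of_eq_comp_mk hq
  have h1 := hle hg
  rw [MonoidHom.mem_ker, hq] at h1
  exact (QuotientGroup.eq_one_iff g).1 (hj (h1.trans (map_one j).symm))

/-- The image of `h` in `L` is torsion, hence conjugate into the image of `j`; `F` carries this
conjugacy back to the quotient by the normal closure. -/
theorem exists_conj_tgenHom_of_pow_mem (hι : Function.Injective ι)
    (N : Subgroup (PresentedGroup rels)) (hN : N.Normal)
    (h : PresentedGroup (substHom ι '' rels)) (n : ℕ) (hn : 0 < n)
    (hh : h ^ n ∈ Subgroup.normalClosure (tgenHom ι rels '' N)) :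
    ∃ (c : PresentedGroup (substHom ι '' rels)) (g : PresentedGroup rels),
      (c * tgenHom ι rels g * c⁻¹)⁻¹ * h ∈ Subgroup.normalClosure (tgenHom ι rels '' N) := by
  obtain ⟨L, _, j, q, F, hj, hq, htors, hF⟩ := exists_recognition hι N
  have hle := normalClosure_le_ker_of_eq_comp_mk hq
  obtain ⟨g, hg⟩ := htors (q h) (isOfFinOrder_iff_pow_eq_one.2
    ⟨n, hn, by simpa using hle hh⟩)
  obtain ⟨g, rfl⟩ := QuotientGroup.mk_surjective g
  rw [← hq] at hg
  obtain ⟨c, hc⟩ := isConj_iff.1 (F.map_isConj hg.symm)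
  obtain ⟨c, rfl⟩ := QuotientGroup.mk_surjective c
  rw [hF, hF] at hc
  exact ⟨c, g, QuotientGroup.eq.1 hc⟩

theorem tgenHom_injective (hι : Function.Injective ι) :
    Function.Injective (tgenHom ι rels) :=
  (injective_iff_map_eq_one _).2 fun g hg =>
    Subgroup.mem_bot.1 (mem_of_tgenHom_mem hι ⊥ inferInstance g (hg ▸ one_mem _))

theorem torlen_presentedGroup_substHom_image (hι : Function.Injective ι) :
    torlen (PresentedGroup (substHom ι '' rels)) = torlen (PresentedGroup rels) :=
  torlen_eq_of_torsion_conj (φ := tgenHom ι rels) (mem_of_tgenHom_mem hι)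
    (exists_conj_tgenHom_of_pow_mem hι)

theorem exists_embedding_and_torlen_eq (hι : Function.Injective ι)
    {S : Set (FreeGroup (Fin 2))} (hS : S = substHom ι '' rels) :
    (∃ φ : PresentedGroup rels →* PresentedGroup S, Function.Injective φ ∧
      ∀ k : I, φ (PresentedGroup.of k) =
        PresentedGroup.mk _ (FreeGroup.mk (wordX (ι k + 1)))) ∧
      torlen (PresentedGroup S) = torlen (PresentedGroup rels) := by
  subst hS
  refine ⟨⟨tgenHom ι rels, tgenHom_injective hι, fun k => ?_⟩,
    torlen_presentedGroup_substHom_image hι⟩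
  rw [← FreeGroup.lift_apply_of (f := fun k => FreeGroup.mk (wordX (ι k + 1)))]
  rfl

theorem substHom_mk (ι : I → ℕ) (w : Word I) :
    substHom ι (FreeGroup.mk w) = FreeGroup.mk (substWord (w.map fun l => (ι l.1, l.2))) := by
  induction w with
  | nil => rfl
  | cons l w ih =>
    obtain ⟨k, s⟩ := l
    rw [← List.singleton_append, ← FreeGroup.mul_mk, map_mul, ih, List.map_append,
      show ∀ u v, substWord (u ++ v) = substWord u ++ substWord v from
        fun u v => List.flatMap_append, ← FreeGroup.mul_mk]
    congr 1
    cases s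
    · simp [substHom, substWord, FreeGroup.inv_mk]
    · simp [substHom, substWord]

end Presented

/-! ### Computability of the substitution -/

section Computability

open Primrec

theorem primrec_invRev {α : Type} [Primcodable α] : Primrec (@FreeGroup.invRev α) :=
  list_reverse.comp (list_map .id
    ((Primrec.pair (fst.comp snd) (Primrec.not.comp (snd.comp snd))).to₂))

theorem primrec_wordPow {α : Type} [Primcodable α] (w : Word α) : Primrec (wordPow w) :=
  (list_flatMap list_range (Primrec.const w).to₂).of_eq fun n => by
    simp [wordPow, List.flatMap, List.map_const']

theorem primrec_wordX : Primrec wordX := by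
  have app : ∀ {f g : ℕ → Word (Fin 2)}, Primrec f → Primrec g → Primrec fun i => f i ++ g i :=
    fun hf hg => list_append.comp hf hg
  exact app (app (app (app (app (app (app (.const _) (primrec_wordPow _)) (.const _))
    (primrec_wordPow _)) (.const _)) (primrec_wordPow _)) (.const _)) (primrec_wordPow _)

theorem primrec_substWord : Primrec substWord := by
  have h : Primrec fun l : ℕ × Bool => wordX (l.1 + 1) := primrec_wordX.comp (succ.comp fst)
  exact list_flatMap .id (((Primrec.cond snd h (primrec_invRev.comp h)).comp snd).to₂)

/-- Composition of an enumerating program with a computable map. -/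
theorem exists_computable_enumerated_image {α β : Type} [Primcodable α] [Primcodable β]
    {f : α → β} (hf : Computable f) :
    ∃ F : Nat.Partrec.Code → Nat.Partrec.Code, Computable F ∧
      ∀ c, enumerated β (F c) = f '' enumerated α c := by
  -- `decode₂` accepts only exact codes of elements of `α`, so other outputs of `c` contribute
  -- nothing.
  obtain ⟨d, hd⟩ := Nat.Partrec.Code.exists_code.1 (Partrec.bind_decode₂_iff.1 hf.partrec)
  refine ⟨fun c => d.comp c,
    (Nat.Partrec.Code.primrec₂_comp.comp (Primrec.const d) Primrec.id).to_comp, fun c => ?_⟩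
  ext y
  simp only [enumerated, Set.mem_ofPred_eq, Set.mem_image, Nat.Partrec.Code.eval, hd]
  constructor
  · rintro ⟨n, hn⟩
    obtain ⟨m, hm, hy⟩ := Part.mem_bind_iff.1 hn
    obtain ⟨x, hx, hy⟩ := Part.mem_bind_iff.1 hy
    rw [Part.mem_ofOption, Option.mem_def, Encodable.decode₂_eq_some] at hx
    refine ⟨x, ⟨n, hx ▸ hm⟩, ?_⟩
    simpa [eq_comm] using hy
  · rintro ⟨x, ⟨n, hn⟩, rfl⟩
    refine ⟨n, Part.mem_bind_iff.2 ⟨_, hn, ?_⟩⟩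
    simp

end Computability

/-! ### Substituted relators in the free group, and the theorem -/

theorem CountablyGenRecPresentation.mk_image_substWord (P : CountablyGenRecPresentation) :
    FreeGroup.mk '' (substWord '' P.relators) =
      substHom (fun k : P.gens => (k : ℕ)) '' P.relatorElements := by
  ext g
  constructor
  · rintro ⟨_, ⟨w, hw, rfl⟩, rfl⟩
    -- Needed to read `w` as a word over the subtype of generators.
    have hmem : ∀ l ∈ w, l.1 ∈ P.gens := P.letters_mem w hw
    let w' : Word P.gens := w.pmap (fun l hl => (⟨l.1, hl⟩, l.2)) hmem
    have hw' : w'.map (fun l => ((l.1 : ℕ), l.2)) = w := by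
      simp [w', List.map_pmap]
    exact ⟨FreeGroup.mk w', ⟨w', by rwa [hw'], rfl⟩, by rw [substHom_mk, hw']⟩
  · rintro ⟨_, ⟨w, hw, rfl⟩, rfl⟩
    exact ⟨_, ⟨_, hw, rfl⟩, (substHom_mk _ w).symm⟩

theorem FinPresentation.mk_image_tgen_relators {n : ℕ} (P : FinPresentation n) :
    FreeGroup.mk '' {w : Word (Fin 2) | w ∈ P.tgen.relators} =
      substHom (fun k : Fin n => (k : ℕ)) ''
        (FreeGroup.mk '' {w : Word (Fin n) | w ∈ P.relators}) := by
  ext g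
  simp [FinPresentation.tgen, FinPresentation.natWord, substHom_mk]

end TorsionLength

open TorsionLength in
theorem mainTheorem2 :
    -- Countably generated recursive presentations.
    (∃ tgen : CountablyGenRecPresentation → RecPresentation 2,
      -- Uniformity: an algorithm finds the program of `tgen P` from the programs of `P`.
      (∃ F : Nat.Partrec.Code × Nat.Partrec.Code → Nat.Partrec.Code, Computable F ∧
        ∀ P : CountablyGenRecPresentation, (tgen P).relCode = F (P.genCode, P.relCode)) ∧
      ∀ P : CountablyGenRecPresentation,
        IsTgen P (tgen P) ∧
        (∃ φ : P.presentedGroup →* (tgen P).presentedGroup,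
          Function.Injective φ ∧
          ∀ k : P.gens, φ (PresentedGroup.of k) =
            PresentedGroup.mk _ (FreeGroup.mk (wordX ((k : ℕ) + 1)))) ∧
        torlen (tgen P).presentedGroup = torlen P.presentedGroup) ∧
    -- Finite presentations.
    ((∃ F : ℕ × List (Word ℕ) → List (Word (Fin 2)), Computable F ∧
        ∀ (n : ℕ) (P : FinPresentation n), P.tgen.relators = F P.data) ∧
      ∀ (n : ℕ) (P : FinPresentation n),
        (∃ φ : P.presentedGroup →* P.tgen.presentedGroup,
          Function.Injective φ ∧
          ∀ k : Fin n, φ (PresentedGroup.of k) =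
            PresentedGroup.mk _ (FreeGroup.mk (wordX ((k : ℕ) + 1)))) ∧
        torlen P.tgen.presentedGroup = torlen P.presentedGroup) := by
  refine ⟨?_, ?_⟩
  · obtain ⟨F, hF, himage⟩ := exists_computable_enumerated_image primrec_substWord.to_comp
    refine ⟨fun P => ⟨F P.relCode⟩, ⟨fun p => F p.2, hF.comp Computable.snd, fun P => rfl⟩,
      fun P => ⟨himage _, ?_⟩⟩
    refine exists_embedding_and_torlen_eq (ι := fun k : P.gens => (k : ℕ))
      Subtype.val_injective ?_
    rw [← P.mk_image_substWord]
    exact congrArg _ (himage _)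
  · refine ⟨⟨fun p => p.2.map substWord, ?_, fun n P => ?_⟩, fun n P => ?_⟩
    · exact (Primrec.list_map Primrec.snd (primrec_substWord.comp Primrec.snd).to₂).to_comp
    · simp [FinPresentation.tgen, FinPresentation.data]
    · exact exists_embedding_and_torlen_eq (ι := fun k : Fin n => (k : ℕ))
        Fin.val_injective P.mk_image_tgen_relators
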